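/- Let $\Omega$ be a $\sigma$-compact metric space, $\nu$ a probability measure on its Borel $\sigma$-field, and $r=I_1\cdots I_N$. Regard tensors in $\mathbb{C}^{I_1\times\cdots\times I_N\times I_1\times\cdots\times I_N}$ as $r\times r$ matrices indexed by multi-indices. A Hermitian tensor $X$ has eigenvalues $\lambda_1(X)\ge\cdots\ge\lambda_r(X)$, counted with multiplicity, and is called nonnegative if they are all $\ge 0$; for any tensor $X$ let $\|X\|_{(k)}=\sum_{i=1}^{k}\lambda_i(|X|)$, where $|X|=\sqrt{X^HX}$, be the Ky Fan $k$-norm. For a nonnegative Hermitian $X$ and a continuous $f:(0,\infty)\to[0,\infty)$ for which $f(0^+)=\lim_{x\downarrow 0}f(x)\in[0,\infty]$ exists (as it does for all functions below), $f(X)$ is defined by functional calculus with $f(0)=f(0^+)$, and every norm of $f(X)$ is taken to be $\infty$ if $f(0^+)=\infty$ and $X$ is singular; in particular this applies to $X^{-p}$. We use $\log 0=-\infty$, $\log\infty=\infty$, $e^{-\infty}=0$, $e^{\infty}=\infty$, and integrals of logarithms take values in $[-\infty,\infty]$. Let $C$ and $D_\tau$ $(\tau\in\Omega)$ be nonnegative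 Hermitian tensors in $\mathbb{C}^{I_1\times\cdots\times I_N\times I_1\times\cdots\times I_N}$ such that $\tau\mapsto D_\tau$ is continuous and $\sup_{\tau}\|D_\tau\|_{(1)}<\infty$. Let $\|\cdot\|_\rho$ be a unitarily invariant norm and suppose that $\int_\Omega\|D_\tau^{-p}\|_\rho\,d\nu(\tau)<\infty$ for every $p>0$. Then the following three statements are equivalent. 1. $\vec\lambda(C)\prec_{\log}\exp\int_\Omega\log\vec\lambda(D_\tau)\,d\nu(\tau)$, that is, $$\prod_{i=1}^{k}\lambda_i(C)\le\prod_{i=1}^{k}\exp\int_\Omega\log\lambda_i(D_\tau)\,d\nu(\tau)\qquad(1\le k\le r),$$ with equality for $k=r$. 2. For every continuous $f:(0,\infty)\to[0,\infty)$ such that $x\mapsto\log f(e^x)$ is convex on $\mathbb{R}$ (as a function with values in $[-\infty,\infty)$) and every $k\in\{1,\dots,r\}$, $$\|f(C)\|_{(k)}\le\exp\int_\Omega\log\|f(D_\tau)\|_{(k)}\,d\nu(\tau).$$ 3. For every continuous $g:(0,\infty)\to[0,\infty)$ such that $x\mapsto g(e^x)$ is convex on $\mathbb{R}$ and every $k\in\{1,\dots,r\}$,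 $$\|g(C)\|_{(k)}\le\int_\Omega\|g(D_\tau)\|_{(k)}\,d\nu(\tau).$$ -/

import Mathlib

open MeasureTheory Filter Topology Set
open scoped ENNReal Matrix

noncomputable section

namespace TensorLogMaj

/-- Multi-indices `(i_1, …, i_N)` with `i_j` ranging over `I_j` values. -/
abbrev MultiIndex {N : ℕ} (I : Fin N → ℕ) : Type := ∀ j : Fin N, Fin (I j)

/-- Complex tensors of size `I_1 × ⋯ × I_N × I_1 × ⋯ × I_N`. The two groups of indices are kept as
two multi-indices, so that addition, the Einstein product (summation over all `N` inner indices),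
the conjugate transpose and the identity tensor are the operations of matrices whose rows and
columns are indexed by multi-indices. -/
abbrev SquareTensor {N : ℕ} (I : Fin N → ℕ) : Type := Matrix (MultiIndex I) (MultiIndex I) ℂ

/-- The number `r = I_1 ⋯ I_N` of Hermitian eigenvalues, counted with multiplicity. -/
abbrev numEig {N : ℕ} (I : Fin N → ℕ) : ℕ := Fintype.card (MultiIndex I)

variable {N : ℕ} {I : Fin N → ℕ}

open scoped Classical in
/-- The Hermitian eigenvalues `λ_1(X) ≥ ⋯ ≥ λ_r(X)` of a Hermitian tensor, in decreasing order and
with multiplicity (and, by default, `0` if `X` is not Hermitian). The index `i : Fin r` is the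
zero-based position. -/
def eig (X : SquareTensor I) : Fin (numEig I) → ℝ :=
  if h : X.IsHermitian then h.eigenvalues₀ else 0

/-- Nonnegative Hermitian tensors: Hermitian tensors whose eigenvalues are all nonnegative. -/
def IsNonnegHermitian (X : SquareTensor I) : Prop := X.IsHermitian ∧ ∀ i, 0 ≤ eig X i

/-- The absolute value `|X| = √(Xᴴ X)`. -/
def tensorAbs (X : SquareTensor I) : SquareTensor I := cfc Real.sqrt (Xᴴ * X)

/-- The Ky Fan `k`-norm: the sum of the `k` largest eigenvalues of `|X|`. For `k = 1` it is the
spectral norm. -/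
def kyFan (k : ℕ) (X : SquareTensor I) : ℝ :=
  ∑ i : Fin (numEig I) with i.val < k, eig (tensorAbs X) i

/-- Unitarily invariant norms on square tensors. -/
def IsUnitarilyInvariantNorm (ρ : Seminorm ℂ (SquareTensor I)) : Prop :=
  (∀ X, ρ X = 0 → X = 0) ∧
  ∀ U ∈ Matrix.unitaryGroup (MultiIndex I) ℂ, ∀ X, ρ (X * U) = ρ X ∧ ρ (U * X) = ρ X

/-- The value `f(0+) ∈ [0, ∞]` of a function `f : (0, ∞) → [0, ∞)`. The upper limit is the limit
whenever the latter exists, as it does for all the functions in use. -/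
def atZero (f : ℝ → ℝ) : ℝ≥0∞ := limsup (fun x => ENNReal.ofReal (f x)) (𝓝[>] 0)

/-- The tensor function `f(X)` of a nonnegative Hermitian tensor `X`, for `f` given on `(0, ∞)` and
extended to `0` by `f(0) = f(0+)` (meaningful if `f(0+) < ∞` or if `X` is invertible). -/
def tensorFun (f : ℝ → ℝ) (X : SquareTensor I) : SquareTensor I :=
  cfc (fun x => if 0 < x then f x else (atZero f).toReal) X

open scoped Classical in
/-- The norm `‖f(X)‖ ∈ [0, ∞]` of a tensor function of a nonnegative Hermitian tensor; it is `∞` if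
`f(0+) = ∞` and `X` is singular, that is, if `0` is an eigenvalue of `X`. -/
def normFun (nrm : SquareTensor I → ℝ) (f : ℝ → ℝ) (X : SquareTensor I) : ℝ≥0∞ :=
  if atZero f = ⊤ ∧ ¬ IsUnit X then ⊤ else ENNReal.ofReal (nrm (tensorFun f X))

/-- The integral `∫ φ dν ∈ [-∞, ∞]` of an extended real function, as the difference of the integrals
of its positive and negative parts (at most one of them is infinite in all uses). -/
def eintegral {Ω : Type*} [MeasurableSpace Ω] (ν : Measure Ω) (φ : Ω → EReal) : EReal :=
  ((∫⁻ τ, (φ τ).toENNReal ∂ν : ℝ≥0∞) : EReal) - ((∫⁻ τ, (-φ τ).toENNReal ∂ν : ℝ≥0∞) : EReal)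

/-- `exp ∫ log φ dν`, the geometric mean of `φ : Ω → [0, ∞]`, with `log 0 = -∞`, `exp (-∞) = 0`,
`log ∞ = ∞`, `exp ∞ = ∞`. -/
def expIntLog {Ω : Type*} [MeasurableSpace Ω] (ν : Measure Ω) (φ : Ω → ℝ≥0∞) : ℝ≥0∞ :=
  EReal.exp (eintegral ν fun τ => ENNReal.log (φ τ))

/-- Log-majorization `x ≺_log y` of vectors with nonnegative, decreasingly ordered entries. -/
def LogMajorizedBy {r : ℕ} (x y : Fin r → ℝ≥0∞) : Prop :=
  (∀ k, 1 ≤ k → k ≤ r → ∏ i : Fin r with i.val < k, x i ≤ ∏ i : Fin r with i.val < k, y i) ∧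
  ∏ i, x i = ∏ i, y i

/-- `f` is a continuous function `(0, ∞) → [0, ∞)`. -/
def IsContNonneg (f : ℝ → ℝ) : Prop := ContinuousOn f (Ioi 0) ∧ ∀ x, 0 < x → 0 ≤ f x

/-- `x ↦ log f(e^x)` is convex on `ℝ`, as a function with values in `[-∞, ∞)` (`log 0 = -∞`). -/
def LogConvexExp (f : ℝ → ℝ) : Prop :=
  ∀ x y a b : ℝ, 0 < a → 0 < b → a + b = 1 →
    ENNReal.log (ENNReal.ofReal (f (Real.exp (a * x + b * y)))) ≤
      (a : EReal) * ENNReal.log (ENNReal.ofReal (f (Real.exp x))) +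
        (b : EReal) * ENNReal.log (ENNReal.ofReal (f (Real.exp y)))

/-- `x ↦ g(e^x)` is convex on `ℝ`. -/
def ConvexExp (g : ℝ → ℝ) : Prop := ConvexOn ℝ univ fun x => g (Real.exp x)

end TensorLogMaj

end

open TensorLogMaj

/-!
The hypotheses make almost every `D_τ` invertible and the numbers `log λ_i(D_τ)` integrable: the
trace of `D_τ⁻¹` is bounded by a multiple of its unitarily invariant norm, and all eigenvalues are
uniformly bounded. Put `m_i = ∫ log λ_i(D_τ) dν`, so that the first statement says that the
`exp (m_i)` log-majorize the eigenvalues of `C`. The equality of the full products makes `C`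
invertible, and the statement becomes the majorization of `(log λ_i(C))` by `(m_i)`
(`logMajorizedBy_ofReal_exp_iff`).

If `h(x) = f(e^x)` is convex, Karamata's inequality applied to `(h - t)⁺` shows that the `k` largest
values among the `h (log λ_i(C))` add up to at most `∑_{i ∈ S} h(m_i)` for some set `S` of `k`
indices (`exists_finset_sum_le_of_majorized`); the sum of the `k` largest entries of a vector `v`
is the minimum over `t` of `k t + ∑ (v_i - t)⁺`. Jensen's inequality for `h` then gives the third
statement. For the second one, `h` vanishes identically or `h = exp ∘ F` with `F` convex, and in the
latter case Jensen's inequality for `F` is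
combined with the convexity of `log ∑ exp` (`ofReal_sum_exp_convexOn_le`). In both cases the sum
over `S` of the values at `D_τ` is at most the Ky Fan norm.

Conversely, only the functions `x ^ p` are needed, and for them the second statement implies the
third because a geometric mean is at most the arithmetic mean. Since
`log x ≤ (x ^ p - 1) / p → log x` as `p → 0⁺`, the inequalities for `p > 0` yield those between
partial products; negative exponents with `k = r` yield the invertibility of `C` and the reverse
inequality between the full products (`logMajorizedBy_of_powers`).

Measurability of `τ ↦ λ_i(D_τ)` comes from the continuity of `tr f(D_τ)` for continuous `f`:
`λ_i > t` holds iff more than `i` eigenvalues exceed `t`, and their number is a supremum of such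
traces.
-/

namespace TensorLogMaj

/-! ### Majorization of real vectors -/

/-- Abel summation: a decreasing weight against a vector with nonnegative partial sums and total
sum zero. -/
lemma sum_mul_nonneg_of_antitone {r : ℕ} {s z : Fin r → ℝ} (hs : Antitone s)
    (hz : ∀ k, 1 ≤ k → k ≤ r → 0 ≤ ∑ i : Fin r with i.val < k, z i) (hz0 : ∑ i, z i = 0) :
    0 ≤ ∑ i, s i * z i := by
  set s' : ℕ → ℝ := fun n => if h : n < r then s ⟨n, h⟩ else 0 with hs'
  set z' : ℕ → ℝ := fun n => if h : n < r then z ⟨n, h⟩ else 0 with hz'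
  have e1 : ∑ i, s i * z i = ∑ i ∈ Finset.range r, s' i • z' i := by
    rw [← Fin.sum_univ_eq_sum_range]; simp [hs', hz']
  have e2 : ∑ i ∈ Finset.range r, z' i = 0 := by
    rw [← Fin.sum_univ_eq_sum_range, ← hz0]; simp [hz']
  have e3 : ∀ k, k ≤ r → ∑ i ∈ Finset.range k, z' i = ∑ i : Fin r with i.val < k, z i := by
    intro k hk
    have : ∑ i : Fin r with i.val < k, z i = ∑ i : Fin r, if i.val < k then z' i else 0 := by
      rw [Finset.sum_filter]; simp [hz']
    rw [this, Fin.sum_univ_eq_sum_range (fun i => if i < k then z' i else 0), ← Finset.sum_filter]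
    congr 1
    ext i; simp only [Finset.mem_range, Finset.mem_filter]; omega
  rw [e1, Finset.sum_range_by_parts, e2, smul_zero, zero_sub, ← Finset.sum_neg_distrib]
  refine Finset.sum_nonneg fun i hi => ?_
  have hi' : i + 1 < r := by have := Finset.mem_range.1 hi; omega
  rw [e3 _ hi'.le, smul_eq_mul]
  have h1 := hz (i + 1) (by omega) hi'.le
  have h2 : s' (i + 1) ≤ s' i := by
    simp only [hs', hi', Nat.lt_of_succ_lt hi', dite_true]
    exact hs (Fin.mk_le_mk.2 (Nat.le_succ i))
  nlinarith

/-- The right derivative of a convex function is the slope of a supporting line. -/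
lemma convexOn_rightDeriv_mul_sub_le {φ : ℝ → ℝ} (hφ : ConvexOn ℝ univ φ) (x y : ℝ) :
    derivWithin φ (Ioi x) x * (y - x) ≤ φ y - φ x := by
  have hx : ∀ x : ℝ, x ∈ interior (univ : Set ℝ) := by simp
  rcases lt_trichotomy x y with h | rfl | h
  · have := hφ.rightDeriv_le_slope_of_mem_interior (hx x) (mem_univ y) h
    rwa [slope_def_field, le_div_iff₀ (sub_pos.2 h)] at this
  · simp
  · have := (hφ.slope_le_leftDeriv_of_mem_interior (mem_univ y) (hx x) h).trans
      (hφ.leftDeriv_le_rightDeriv_of_mem_interior (hx x))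
    rw [slope_def_field, div_le_iff₀ (sub_pos.2 h)] at this
    linarith

/-- **Karamata's inequality**: convex functions are monotone under majorization. -/
lemma sum_convexOn_le_of_majorized {r : ℕ} {x y : Fin r → ℝ} (hx : Antitone x)
    (hxy : ∀ k, 1 ≤ k → k ≤ r →
      ∑ i : Fin r with i.val < k, x i ≤ ∑ i : Fin r with i.val < k, y i)
    (hsum : ∑ i, x i = ∑ i, y i) {φ : ℝ → ℝ} (hφ : ConvexOn ℝ univ φ) :
    ∑ i, φ (x i) ≤ ∑ i, φ (y i) := by
  have hs : Antitone fun i => derivWithin φ (Ioi (x i)) (x i) := fun i j hij =>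
    hφ.monotoneOn_rightDeriv (by simp) (by simp) (hx hij)
  have h := sum_mul_nonneg_of_antitone hs (z := fun i => y i - x i)
    (fun k h1 h2 => by rw [Finset.sum_sub_distrib]; exact sub_nonneg.2 (hxy k h1 h2))
    (by rw [Finset.sum_sub_distrib, hsum, sub_self])
  have h' := Finset.sum_le_sum fun i (_ : i ∈ Finset.univ) =>
    convexOn_rightDeriv_mul_sub_le hφ (x i) (y i)
  rw [Finset.sum_sub_distrib] at h'
  linarith

lemma card_filter_val_lt {r k : ℕ} (hk : k ≤ r) :
    (Finset.univ.filter fun i : Fin r => i.val < k).card = k := by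
  rw [Fin.card_filter_val_lt, min_eq_right hk]

/-- Every sum of `k` entries is bounded by `k t + ∑ (v_i - t)⁺`. -/
lemma sum_le_card_mul_add_sum_max {ι : Type*} [Fintype ι] (v : ι → ℝ) (S : Finset ι) (t : ℝ) :
    ∑ i ∈ S, v i ≤ S.card * t + ∑ i, max (v i - t) 0 := by
  calc ∑ i ∈ S, v i ≤ ∑ i ∈ S, (t + max (v i - t) 0) :=
        Finset.sum_le_sum fun i _ => by linarith [le_max_left (v i - t) 0]
    _ = S.card * t + ∑ i ∈ S, max (v i - t) 0 := by
        rw [Finset.sum_add_distrib, Finset.sum_const, nsmul_eq_mul]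
    _ ≤ _ := by
        gcongr
        · exact Finset.subset_univ S

/-- For decreasingly ordered entries the bound `k t + ∑ (w_i - t)⁺` on the sum of the first `k`
entries is attained at the `k`-th entry. -/
lemma exists_sum_eq_mul_add_sum_max {r : ℕ} {w : Fin r → ℝ} (hw : Antitone w) {k : ℕ}
    (hk1 : 1 ≤ k) (hkr : k ≤ r) :
    ∃ t : ℝ, ∑ i : Fin r with i.val < k, w i = k * t + ∑ i, max (w i - t) 0 := by
  refine ⟨w ⟨k - 1, by omega⟩, ?_⟩
  set t := w ⟨k - 1, by omega⟩
  have h1 : ∑ i, max (w i - t) 0 = ∑ i : Fin r with i.val < k, (w i - t) := by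
    rw [Finset.sum_filter]
    refine Finset.sum_congr rfl fun i _ => ?_
    split_ifs with h
    · exact max_eq_left (sub_nonneg.2 (hw (Fin.le_def.2 (by simp; omega))))
    · exact max_eq_right (sub_nonpos.2 (hw (Fin.le_def.2 (by simp; omega))))
  rw [h1, Finset.sum_sub_distrib, Finset.sum_const, card_filter_val_lt hkr, nsmul_eq_mul]
  ring

/-- If `w` is the decreasing rearrangement of `v`, every sum of `k` entries of `v` is at most the sum
of the first `k` entries of `w`. The rearrangement is encoded by `∑ φ (w_i) = ∑ φ (v_i)` for
all `φ`. -/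
lemma sum_le_sum_of_rearrangement {ι : Type*} [Fintype ι] {r : ℕ} {w : Fin r → ℝ} {v : ι → ℝ}
    (hw : Antitone w) (hwv : ∀ φ : ℝ → ℝ, ∑ i, φ (w i) = ∑ i, φ (v i)) {S : Finset ι}
    (hS1 : 1 ≤ S.card) (hSr : S.card ≤ r) :
    ∑ i ∈ S, v i ≤ ∑ i : Fin r with i.val < S.card, w i := by
  obtain ⟨t, ht⟩ := exists_sum_eq_mul_add_sum_max hw hS1 hSr
  rw [ht, hwv fun x => max (x - t) 0]
  exact sum_le_card_mul_add_sum_max v S t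

/-- Two decreasing rearrangements of the same vector have the same partial sums. -/
lemma sum_eq_sum_of_rearrangement {r : ℕ} {w v : Fin r → ℝ} (hw : Antitone w) (hv : Antitone v)
    (hwv : ∀ φ : ℝ → ℝ, ∑ i, φ (w i) = ∑ i, φ (v i)) {k : ℕ} (hk1 : 1 ≤ k) (hkr : k ≤ r) :
    ∑ i : Fin r with i.val < k, w i = ∑ i : Fin r with i.val < k, v i := by
  have hc := card_filter_val_lt hkr
  apply le_antisymm
  · have := sum_le_sum_of_rearrangement hv (fun φ => (hwv φ).symm)
      (S := Finset.univ.filter fun i : Fin r => i.val < k) (by omega) (by omega)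
    rwa [hc] at this
  · have := sum_le_sum_of_rearrangement hw hwv
      (S := Finset.univ.filter fun i : Fin r => i.val < k) (by omega) (by omega)
    rwa [hc] at this

/-- The `k` largest entries of a vector form a set `S` on which `k t + ∑ (v_i - t)⁺` is attained. -/
lemma exists_finset_sum_eq_mul_add_sum_max {r : ℕ} (v : Fin r → ℝ) {k : ℕ}
    (hk1 : 1 ≤ k) (hkr : k ≤ r) :
    ∃ S : Finset (Fin r), S.card = k ∧ ∃ t : ℝ, ∑ i ∈ S, v i = k * t + ∑ i, max (v i - t) 0 := by
  set σ := Tuple.sort fun i => -v i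
  have hσ : Antitone fun i => v (σ i) := fun i j hij => by
    have := Tuple.monotone_sort (fun i => -v i) hij
    simpa using this
  obtain ⟨t, ht⟩ := exists_sum_eq_mul_add_sum_max hσ hk1 hkr
  refine ⟨(Finset.univ.filter fun i : Fin r => i.val < k).map σ.toEmbedding, ?_, t, ?_⟩
  · rw [Finset.card_map, card_filter_val_lt hkr]
  · rw [Finset.sum_map]
    simp only [Equiv.coe_toEmbedding]
    rw [ht, Equiv.sum_comp σ fun i => max (v i - t) 0]

/-- Convex images of majorized vectors are weakly majorized: the sum of the `k` largest entries of
`φ ∘ x` is at most a sum of `k` entries of `φ ∘ y`. -/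
lemma exists_finset_sum_le_of_majorized {r : ℕ} {x y : Fin r → ℝ} (hx : Antitone x)
    (hxy : ∀ k, 1 ≤ k → k ≤ r →
      ∑ i : Fin r with i.val < k, x i ≤ ∑ i : Fin r with i.val < k, y i)
    (hsum : ∑ i, x i = ∑ i, y i) {φ : ℝ → ℝ} (hφ : ConvexOn ℝ univ φ) {w : Fin r → ℝ}
    (hw : ∀ ψ : ℝ → ℝ, ∑ i, ψ (w i) = ∑ i, ψ (φ (x i))) {k : ℕ} (hk1 : 1 ≤ k) (hkr : k ≤ r) :
    ∃ S : Finset (Fin r), S.card = k ∧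
      ∑ i : Fin r with i.val < k, w i ≤ ∑ i ∈ S, φ (y i) := by
  obtain ⟨S, hS, t, ht⟩ := exists_finset_sum_eq_mul_add_sum_max (fun i => φ (y i)) hk1 hkr
  refine ⟨S, hS, ?_⟩
  have h1 := sum_le_card_mul_add_sum_max w (Finset.univ.filter fun i : Fin r => i.val < k) t
  rw [card_filter_val_lt hkr, hw fun x => max (x - t) 0] at h1
  rw [ht]
  have hc : ConvexOn ℝ univ fun x => max (φ x - t) 0 :=
    (hφ.sub (concaveOn_const t convex_univ)).sup (convexOn_const 0 convex_univ)
  have h2 := sum_convexOn_le_of_majorized hx hxy hsum hc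
  linarith

/-! ### Geometric means and Jensen inequalities -/

section Integrals

variable {Ω : Type*} [MeasurableSpace Ω] {ν : Measure Ω}

lemma eintegral_mono_ae {φ ψ : Ω → EReal} (h : φ ≤ᵐ[ν] ψ) : eintegral ν φ ≤ eintegral ν ψ := by
  refine EReal.sub_le_sub ?_ ?_
  · refine EReal.coe_ennreal_le_coe_ennreal_iff.2 (lintegral_mono_ae ?_)
    filter_upwards [h] with τ hτ using EReal.toENNReal_le_toENNReal hτ
  · refine EReal.coe_ennreal_le_coe_ennreal_iff.2 (lintegral_mono_ae ?_)
    filter_upwards [h] with τ hτ using EReal.toENNReal_le_toENNReal (EReal.neg_le_neg_iff.2 hτ)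

lemma eintegral_coe {u : Ω → ℝ} (hu : Integrable u ν) :
    eintegral ν (fun τ => (u τ : EReal)) = ((∫ τ, u τ ∂ν : ℝ) : EReal) := by
  have h1 : ∫⁻ τ, ENNReal.ofReal (u τ) ∂ν ≠ ⊤ := hu.lintegral_lt_top.ne
  have h2 : ∫⁻ τ, ENNReal.ofReal (-u τ) ∂ν ≠ ⊤ := hu.neg.lintegral_lt_top.ne
  have e1 : ∀ x : ℝ, (x : EReal).toENNReal = ENNReal.ofReal x := fun x => by simp
  have e2 : ∀ x : ℝ, (-(x : EReal)).toENNReal = ENNReal.ofReal (-x) := fun x => by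
    rw [← EReal.coe_neg, e1]
  simp only [eintegral, e1, e2]
  rw [integral_eq_lintegral_pos_part_sub_lintegral_neg_part hu, EReal.coe_sub,
    EReal.coe_ennreal_toReal h1, EReal.coe_ennreal_toReal h2]

/-- An extended integral bounded below by an integrable function is infinite unless the integrand
is integrable. -/
lemma eintegral_coe_eq_top {u l : Ω → ℝ} (hu : AEStronglyMeasurable u ν) (hl : Integrable l ν)
    (hlu : ∀ᵐ τ ∂ν, l τ ≤ u τ) (hnot : ¬ Integrable u ν) :
    eintegral ν (fun τ => (u τ : EReal)) = ⊤ := by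
  have e1 : ∀ x : ℝ, (x : EReal).toENNReal = ENNReal.ofReal x := fun x => by simp
  have e2 : ∀ x : ℝ, (-(x : EReal)).toENNReal = ENNReal.ofReal (-x) := fun x => by
    rw [← EReal.coe_neg, e1]
  have h2 : ∫⁻ τ, ENNReal.ofReal (-u τ) ∂ν ≠ ⊤ := by
    refine ne_top_of_le_ne_top hl.neg.lintegral_lt_top.ne (lintegral_mono_ae ?_)
    filter_upwards [hlu] with τ hτ using ENNReal.ofReal_le_ofReal (neg_le_neg hτ)
  have h1 : ∫⁻ τ, ENNReal.ofReal (u τ) ∂ν = ⊤ := by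
    by_contra h1
    refine hnot ⟨hu, ?_⟩
    have : ∫⁻ τ, ‖u τ‖ₑ ∂ν
        ≤ ∫⁻ τ, (ENNReal.ofReal (u τ) + ENNReal.ofReal (-u τ)) ∂ν := by
      refine lintegral_mono fun τ => ?_
      rw [Real.enorm_eq_ofReal_abs]
      rcases abs_cases (u τ) with ⟨h, _⟩ | ⟨h, _⟩ <;> rw [h]
      · exact le_self_add
      · exact le_add_self
    refine lt_of_le_of_lt this ?_
    rw [lintegral_add_left' hu.aemeasurable.ennreal_ofReal]
    exact ENNReal.add_lt_top.2 ⟨Ne.lt_top h1, Ne.lt_top h2⟩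
  simp only [eintegral, e1, e2, h1]
  lift (∫⁻ τ, ENNReal.ofReal (-u τ) ∂ν) to NNReal using h2 with b
  exact EReal.top_sub_coe (b : ℝ)

lemma expIntLog_mono_ae {φ ψ : Ω → ℝ≥0∞} (h : φ ≤ᵐ[ν] ψ) : expIntLog ν φ ≤ expIntLog ν ψ := by
  refine EReal.exp_monotone (eintegral_mono_ae ?_)
  filter_upwards [h] with τ hτ using ENNReal.log_monotone hτ

lemma expIntLog_congr_ae {φ ψ : Ω → ℝ≥0∞} (h : φ =ᵐ[ν] ψ) : expIntLog ν φ = expIntLog ν ψ :=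
  le_antisymm (expIntLog_mono_ae h.le) (expIntLog_mono_ae h.symm.le)

lemma log_ofReal_exp (x : ℝ) : ENNReal.log (ENNReal.ofReal (Real.exp x)) = (x : EReal) := by
  rw [ENNReal.log_ofReal, if_neg (Real.exp_pos x).not_ge, Real.log_exp]

lemma expIntLog_ofReal_exp {u : Ω → ℝ} (hu : Integrable u ν) :
    expIntLog ν (fun τ => ENNReal.ofReal (Real.exp (u τ)))
      = ENNReal.ofReal (Real.exp (∫ τ, u τ ∂ν)) := by
  simp only [expIntLog, log_ofReal_exp]
  rw [eintegral_coe hu, EReal.exp_coe]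

variable [IsProbabilityMeasure ν]

/-- Jensen's inequality for nonnegative convex functions, the right-hand side being possibly
infinite. -/
lemma ofReal_convexOn_integral_le {h : ℝ → ℝ} (hh : ConvexOn ℝ univ h) (h0 : ∀ x, 0 ≤ h x)
    {u : Ω → ℝ} (hu : Integrable u ν) :
    ENNReal.ofReal (h (∫ τ, u τ ∂ν)) ≤ ∫⁻ τ, ENNReal.ofReal (h (u τ)) ∂ν := by
  have hcont : Continuous h := continuousOn_univ.1 (hh.continuousOn isOpen_univ)
  by_cases hfin : ∫⁻ τ, ENNReal.ofReal (h (u τ)) ∂ν = ⊤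
  · rw [hfin]; exact le_top
  have hint : Integrable (fun τ => h (u τ)) ν :=
    (lintegral_ofReal_ne_top_iff_integrable (hcont.comp_aestronglyMeasurable hu.1)
      (Eventually.of_forall fun τ => h0 _)).1 hfin
  rw [← ofReal_integral_eq_lintegral_ofReal hint (Eventually.of_forall fun τ => h0 _)]
  exact ENNReal.ofReal_le_ofReal
    (hh.map_integral_le hcont.continuousOn isClosed_univ (by simp) hu hint)

lemma exp_integral_le_integral_exp {u : Ω → ℝ} (hu : Integrable u ν)
    (he : Integrable (fun τ => Real.exp (u τ)) ν) :
    Real.exp (∫ τ, u τ ∂ν) ≤ ∫ τ, Real.exp (u τ) ∂ν :=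
  convexOn_exp.map_integral_le Real.continuous_exp.continuousOn isClosed_univ (by simp) hu he

/-- Convexity of `log ∑ exp`: a sum of geometric means is at most the geometric mean of the sum. -/
lemma sum_exp_integral_le {ι : Type*} {S : Finset ι} (hS : S.Nonempty) {u : ι → Ω → ℝ}
    (hu : ∀ i ∈ S, Integrable (u i) ν)
    (hZ : Integrable (fun τ => Real.log (∑ i ∈ S, Real.exp (u i τ))) ν) :
    ∑ i ∈ S, Real.exp (∫ τ, u i τ ∂ν)
      ≤ Real.exp (∫ τ, Real.log (∑ i ∈ S, Real.exp (u i τ)) ∂ν) := by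
  set Z : Ω → ℝ := fun τ => ∑ i ∈ S, Real.exp (u i τ)
  have hZpos : ∀ τ, 0 < Z τ := fun τ => Finset.sum_pos (fun i _ => Real.exp_pos _) hS
  have hsub : ∀ i ∈ S, Integrable (fun τ => u i τ - Real.log (Z τ)) ν := fun i hi =>
    (hu i hi).sub hZ
  have hle : ∀ i ∈ S, ∀ τ, u i τ ≤ Real.log (Z τ) := fun i hi τ => by
    rw [Real.le_log_iff_exp_le (hZpos τ)]
    exact Finset.single_le_sum (f := fun i => Real.exp (u i τ))
      (fun j _ => (Real.exp_pos _).le) hi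
  have hexp : ∀ i ∈ S, Integrable (fun τ => Real.exp (u i τ - Real.log (Z τ))) ν := fun i hi =>
    Integrable.of_bound (Real.continuous_exp.comp_aestronglyMeasurable (hsub i hi).1) 1
      (Eventually.of_forall fun τ => by
        rw [Real.norm_of_nonneg (Real.exp_pos _).le, Real.exp_le_one_iff]
        linarith [hle i hi τ])
  -- After division by `Z` the sum of the integrands is `1`, and Jensen applies termwise.
  have key : ∑ i ∈ S, Real.exp (∫ τ, (u i τ - Real.log (Z τ)) ∂ν) ≤ 1 := by
    calc _ ≤ ∑ i ∈ S, ∫ τ, Real.exp (u i τ - Real.log (Z τ)) ∂ν :=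
          Finset.sum_le_sum fun i hi => exp_integral_le_integral_exp (hsub i hi) (hexp i hi)
      _ = ∫ τ, ∑ i ∈ S, Real.exp (u i τ - Real.log (Z τ)) ∂ν := (integral_finsetSum S hexp).symm
      _ = ∫ τ, (1 : ℝ) ∂ν := by
          congr 1; ext τ
          simp only [Real.exp_sub, Real.exp_log (hZpos τ), ← Finset.sum_div]
          exact div_self (hZpos τ).ne'
      _ = 1 := by simp
  have : ∑ i ∈ S, Real.exp (∫ τ, (u i τ - Real.log (Z τ)) ∂ν)
      = (∑ i ∈ S, Real.exp (∫ τ, u i τ ∂ν)) / Real.exp (∫ τ, Real.log (Z τ) ∂ν) := by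
    rw [Finset.sum_div]
    exact Finset.sum_congr rfl fun i hi => by rw [integral_sub (hu i hi) hZ, Real.exp_sub]
  rw [this, div_le_one (Real.exp_pos _)] at key
  exact key

/-- The bound `∑ exp (F (m_i)) ≤ exp ∫ log ∑ exp (F (u_i))` for convex `F` and the means `m_i` of
`u_i`, where the right-hand side may be infinite. -/
lemma ofReal_sum_exp_convexOn_le {ι : Type*} {S : Finset ι} (hS : S.Nonempty) {F : ℝ → ℝ}
    (hF : ConvexOn ℝ univ F) {u : ι → Ω → ℝ} (hu : ∀ i, Integrable (u i) ν) :
    ENNReal.ofReal (∑ i ∈ S, Real.exp (F (∫ τ, u i τ ∂ν)))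
      ≤ expIntLog ν fun τ => ENNReal.ofReal (∑ i ∈ S, Real.exp (F (u i τ))) := by
  have hcont : Continuous F := continuousOn_univ.1 (hF.continuousOn isOpen_univ)
  set Z : Ω → ℝ := fun τ => ∑ i ∈ S, Real.exp (F (u i τ))
  have hZpos : ∀ τ, 0 < Z τ := fun τ => Finset.sum_pos (fun i _ => Real.exp_pos _) hS
  have hle : ∀ i ∈ S, ∀ τ, F (u i τ) ≤ Real.log (Z τ) := fun i hi τ => by
    rw [Real.le_log_iff_exp_le (hZpos τ)]
    exact Finset.single_le_sum (f := fun i => Real.exp (F (u i τ)))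
      (fun j _ => (Real.exp_pos _).le) hi
  have hmeas : ∀ i, AEStronglyMeasurable (fun τ => F (u i τ)) ν := fun i =>
    hcont.comp_aestronglyMeasurable (hu i).1
  have hZmeas : AEStronglyMeasurable (fun τ => Real.log (Z τ)) ν :=
    (Real.measurable_log.comp_aemeasurable (Finset.aemeasurable_fun_sum S fun i _ =>
      Real.measurable_exp.comp_aemeasurable (hmeas i).aemeasurable)).aestronglyMeasurable
  -- A supporting line of `F` at `0` bounds `F ∘ u i` below by an integrable function.
  set l : ι → Ω → ℝ := fun i τ => F 0 + derivWithin F (Ioi 0) 0 * u i τ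
  have hl : ∀ i, Integrable (l i) ν := fun i =>
    (integrable_const _).add ((hu i).const_mul _)
  have hlu : ∀ i τ, l i τ ≤ F (u i τ) := fun i τ => by
    have := convexOn_rightDeriv_mul_sub_le hF 0 (u i τ)
    simp only [l]; rw [sub_zero] at this; linarith
  have hZexp : ∀ τ, Z τ = Real.exp (Real.log (Z τ)) := fun τ => (Real.exp_log (hZpos τ)).symm
  have e : (fun τ => ENNReal.ofReal (Z τ))
      = fun τ => ENNReal.ofReal (Real.exp (Real.log (Z τ))) := by
    ext τ; rw [← hZexp]
  by_cases hZ : Integrable (fun τ => Real.log (Z τ)) ν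
  · have hFu : ∀ i ∈ S, Integrable (fun τ => F (u i τ)) ν := fun i hi =>
      integrable_of_le_of_le (hmeas i) (Eventually.of_forall (hlu i))
        (Eventually.of_forall (hle i hi)) (hl i) hZ
    rw [e, expIntLog_ofReal_exp hZ]
    refine ENNReal.ofReal_le_ofReal (le_trans ?_ (sum_exp_integral_le hS hFu hZ))
    refine Finset.sum_le_sum fun i hi => Real.exp_le_exp.2 ?_
    exact hF.map_integral_le hcont.continuousOn isClosed_univ (by simp) (hu i) (hFu i hi)
  · obtain ⟨j, hj⟩ := hS
    have : eintegral ν (fun τ => ((Real.log (Z τ) : ℝ) : EReal)) = ⊤ :=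
      eintegral_coe_eq_top hZmeas (hl j)
        (Eventually.of_forall fun τ => (hlu j τ).trans (hle j hj τ)) hZ
    rw [e]
    simp only [expIntLog, log_ofReal_exp]
    rw [this, EReal.exp_top]
    exact le_top

/-- The geometric mean is the limit of power means: `∫ (exp (p u) - 1) / p → ∫ u` as
`p = 1 / (n + 1) → 0`. -/
lemma tendsto_integral_exp_mul_sub_one_div {u : Ω → ℝ} (hu : Integrable u ν)
    (he : Integrable (fun τ => Real.exp (u τ)) ν) :
    Tendsto (fun n : ℕ => ∫ τ, (Real.exp (1 / ((n : ℝ) + 1) * u τ) - 1) / (1 / ((n : ℝ) + 1)) ∂ν)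
      atTop (𝓝 (∫ τ, u τ ∂ν)) := by
  refine tendsto_integral_of_dominated_convergence
    (fun τ => |u τ| + |Real.exp (u τ) - 1|) ?_ ?_ ?_ ?_
  · intro n
    exact (by fun_prop : Continuous fun x : ℝ =>
      (Real.exp (1 / ((n : ℝ) + 1) * x) - 1) / (1 / ((n : ℝ) + 1))).comp_aestronglyMeasurable hu.1
  · exact hu.abs.add (he.sub (integrable_const 1)).abs
  · intro n
    refine Eventually.of_forall fun τ => ?_
    have hp : (0 : ℝ) < 1 / ((n : ℝ) + 1) := by positivity
    have hp1 : 1 / ((n : ℝ) + 1) ≤ 1 := by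
      rw [div_le_one (by positivity)]; linarith [(Nat.cast_nonneg n : (0 : ℝ) ≤ n)]
    set p := 1 / ((n : ℝ) + 1)
    have h1 : u τ ≤ (Real.exp (p * u τ) - 1) / p := by
      rw [le_div_iff₀ hp]; linarith [Real.add_one_le_exp (p * u τ)]
    have h2 : (Real.exp (p * u τ) - 1) / p ≤ Real.exp (u τ) - 1 := by
      rw [div_le_iff₀ hp]
      have := convexOn_exp.2 (mem_univ (u τ)) (mem_univ 0) hp.le (sub_nonneg.2 hp1) (by ring)
      simp only [smul_eq_mul, mul_zero, add_zero, Real.exp_zero] at this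
      linarith
    rw [Real.norm_eq_abs, abs_le]
    exact ⟨by linarith [neg_abs_le (u τ), abs_nonneg (Real.exp (u τ) - 1)],
      by linarith [le_abs_self (Real.exp (u τ) - 1), abs_nonneg (u τ)]⟩
  · refine Eventually.of_forall fun τ => ?_
    have hd : HasDerivAt (fun p : ℝ => Real.exp (p * u τ)) (u τ) 0 := by
      simpa using ((hasDerivAt_id (0 : ℝ)).mul_const (u τ)).exp
    have h0 : Tendsto (fun n : ℕ => 1 / ((n : ℝ) + 1)) atTop (𝓝[≠] 0) :=
      tendsto_nhdsWithin_iff.2 ⟨tendsto_one_div_add_atTop_nhds_zero_nat,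
        Eventually.of_forall fun n => by
          have : (0 : ℝ) < 1 / ((n : ℝ) + 1) := by positivity
          exact this.ne'⟩
    refine ((hasDerivAt_iff_tendsto_slope.1 hd).comp h0).congr fun n => ?_
    simp [slope_def_field]

end Integrals

/-! ### Eigenvalues and Ky Fan norms of tensor functions -/

section Eigenvalues

variable {N : ℕ} {I : Fin N → ℕ}

lemma eig_antitone (X : SquareTensor I) : Antitone (eig X) := by
  unfold eig
  split_ifs with h
  · exact h.eigenvalues₀_antitone
  · exact antitone_const

/-- Eigenvalues indexed by position and by multi-index agree up to reordering. -/
lemma sum_eig_eq {X : SquareTensor I} (hX : X.IsHermitian) (φ : ℝ → ℝ) :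
    ∑ i, φ (eig X i) = ∑ j, φ (hX.eigenvalues j) := by
  simp only [eig, hX, dite_true, Matrix.IsHermitian.eigenvalues]
  exact (Equiv.sum_comp _ fun i => φ (hX.eigenvalues₀ i)).symm

lemma range_eig {X : SquareTensor I} (hX : X.IsHermitian) : range (eig X) = spectrum ℝ X := by
  rw [hX.spectrum_real_eq_range_eigenvalues]
  have h1 : eig X = hX.eigenvalues₀ := by simp [eig, hX]
  have h2 : hX.eigenvalues
      = hX.eigenvalues₀ ∘ (Fintype.equivOfCardEq (Fintype.card_fin _)).symm := rfl
  rw [h1, h2, EquivLike.range_comp]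

lemma isHermitian_cfc (f : ℝ → ℝ) (X : SquareTensor I) : (cfc f X).IsHermitian :=
  cfc_predicate f X

lemma continuousOn_spectrum (f : ℝ → ℝ) (X : SquareTensor I) :
    ContinuousOn f (spectrum ℝ X) :=
  Matrix.finite_real_spectrum.continuousOn f

/-- Spectral mapping with multiplicities: the eigenvalues of `f(X)` are a rearrangement of the
values of `f` at the eigenvalues of `X`. -/
lemma sum_eig_cfc {X : SquareTensor I} (hX : X.IsHermitian) (f φ : ℝ → ℝ) :
    ∑ i, φ (eig (cfc f X) i) = ∑ i, φ (f (eig X i)) := by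
  have hY := isHermitian_cfc f X
  rw [sum_eig_eq hX fun x => φ (f x), sum_eig_eq hY]
  have h1 := hY.roots_charpoly_eq_eigenvalues
  rw [hX.charpoly_cfc_eq f, Polynomial.roots_prod _ _
    (by simp [Finset.prod_ne_zero_iff, Polynomial.X_sub_C_ne_zero])] at h1
  have h2 := congrArg (fun m => (m.map fun z : ℂ => φ z.re).sum) h1
  simpa using h2.symm

lemma trace_re_eq {X : SquareTensor I} (hX : X.IsHermitian) : X.trace.re = ∑ i, eig X i := by
  rw [hX.trace_eq_sum_eigenvalues, sum_eig_eq hX fun x => x]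
  simp

lemma isUnit_iff_forall_eig_pos {X : SquareTensor I} (hX : IsNonnegHermitian X) :
    IsUnit X ↔ ∀ i, 0 < eig X i := by
  have h := spectrum.zero_mem_iff ℝ (a := X)
  rw [← not_iff_not, ← h, ← range_eig hX.1]
  simp only [mem_range, not_forall, not_lt]
  exact exists_congr fun i => ⟨fun h => h.le, fun h => le_antisymm h (hX.2 i)⟩

lemma tensorAbs_eq_self {X : SquareTensor I} (hX : IsNonnegHermitian X) : tensorAbs X = X := by
  have hsa : IsSelfAdjoint X := hX.1
  have h1 : Xᴴ * X = cfc (fun x : ℝ => x * x) X := by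
    rw [cfc_mul (fun x : ℝ => x) (fun x : ℝ => x) X (continuousOn_spectrum _ X)
      (continuousOn_spectrum _ X), cfc_id' ℝ X hsa, hX.1.eq]
  rw [tensorAbs, h1, ← cfc_comp Real.sqrt (fun x : ℝ => x * x) X hsa
    Real.continuous_sqrt.continuousOn (continuousOn_spectrum _ X)]
  conv_rhs => rw [← cfc_id' ℝ X hsa]
  refine cfc_congr fun x hx => ?_
  rw [← range_eig hX.1] at hx
  obtain ⟨i, rfl⟩ := hx
  exact Real.sqrt_mul_self (hX.2 i)

lemma kyFan_eq {X : SquareTensor I} (hX : IsNonnegHermitian X) (k : ℕ) :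
    kyFan k X = ∑ i : Fin (numEig I) with i.val < k, eig X i := by
  rw [kyFan, tensorAbs_eq_self hX]

/-- A function that is nonnegative at the eigenvalues yields a nonnegative tensor. -/
lemma isNonnegHermitian_cfc {X : SquareTensor I} (hX : X.IsHermitian) {f : ℝ → ℝ}
    (hf : ∀ i, 0 ≤ f (eig X i)) : IsNonnegHermitian (cfc f X) := by
  refine ⟨isHermitian_cfc f X, ?_⟩
  have h := sum_eig_cfc hX f fun x => min x 0
  rw [Finset.sum_eq_zero (f := fun i => min (f (eig X i)) 0) fun i _ => min_eq_right (hf i),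
    Finset.sum_eq_zero_iff_of_nonpos fun i _ => min_le_right _ _] at h
  exact fun i => min_eq_right_iff.1 (h i (Finset.mem_univ i))

/-- On an invertible nonnegative tensor the value at `0` does not matter. -/
lemma tensorFun_eq_cfc {X : SquareTensor I} (hX : IsNonnegHermitian X) (hu : IsUnit X)
    (f : ℝ → ℝ) : tensorFun f X = cfc f X := by
  refine cfc_congr fun x hx => ?_
  rw [← range_eig hX.1] at hx
  obtain ⟨i, rfl⟩ := hx
  exact if_pos ((isUnit_iff_forall_eig_pos hX).1 hu i)

lemma normFun_eq_of_isUnit {X : SquareTensor I} (hX : IsNonnegHermitian X) (hu : IsUnit X)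
    (nrm : SquareTensor I → ℝ) (f : ℝ → ℝ) :
    normFun nrm f X = ENNReal.ofReal (nrm (cfc f X)) := by
  rw [normFun, if_neg (fun h => h.2 hu), tensorFun_eq_cfc hX hu]

lemma normFun_kyFan_eq {X : SquareTensor I} (hX : IsNonnegHermitian X) (hu : IsUnit X)
    {f : ℝ → ℝ} (hf : ∀ x, 0 < x → 0 ≤ f x) (k : ℕ) :
    normFun (kyFan k) f X
      = ENNReal.ofReal (∑ i : Fin (numEig I) with i.val < k, eig (cfc f X) i) := by
  rw [normFun_eq_of_isUnit hX hu, kyFan_eq (isNonnegHermitian_cfc hX.1 fun i =>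
    hf _ ((isUnit_iff_forall_eig_pos hX).1 hu i))]

/-- The Ky Fan `k`-norm of `f(X)` dominates every sum of `k` values of `f` at eigenvalues. -/
lemma ofReal_sum_le_normFun_kyFan {X : SquareTensor I} (hX : IsNonnegHermitian X) (hu : IsUnit X)
    {f : ℝ → ℝ} (hf : ∀ x, 0 < x → 0 ≤ f x) {S : Finset (Fin (numEig I))}
    (hS1 : 1 ≤ S.card) :
    ENNReal.ofReal (∑ i ∈ S, f (eig X i)) ≤ normFun (kyFan S.card) f X := by
  rw [normFun_kyFan_eq hX hu hf]
  exact ENNReal.ofReal_le_ofReal (sum_le_sum_of_rearrangement (eig_antitone _)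
    (sum_eig_cfc hX.1 f) hS1 (by simpa using Finset.card_le_univ S))

/-- For increasing `f` the `k` largest eigenvalues of `f(X)` are the values of `f` at the `k`
largest eigenvalues of `X`. -/
lemma normFun_kyFan_eq_of_monotoneOn {X : SquareTensor I} (hX : IsNonnegHermitian X)
    (hu : IsUnit X) {f : ℝ → ℝ} (hf : ∀ x, 0 < x → 0 ≤ f x) (hmono : MonotoneOn f (Ioi 0))
    {k : ℕ} (hk1 : 1 ≤ k) (hkr : k ≤ numEig I) :
    normFun (kyFan k) f X
      = ENNReal.ofReal (∑ i : Fin (numEig I) with i.val < k, f (eig X i)) := by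
  have hpos := (isUnit_iff_forall_eig_pos hX).1 hu
  rw [normFun_kyFan_eq hX hu hf, sum_eq_sum_of_rearrangement (eig_antitone _)
    (fun i j hij => hmono (hpos j) (hpos i) (eig_antitone X hij)) (sum_eig_cfc hX.1 f) hk1 hkr]

/-- The Ky Fan norm of full order is the trace. -/
lemma normFun_kyFan_numEig {X : SquareTensor I} (hX : IsNonnegHermitian X)
    (hu : IsUnit X) {f : ℝ → ℝ} (hf : ∀ x, 0 < x → 0 ≤ f x) :
    normFun (kyFan (numEig I)) f X = ENNReal.ofReal (∑ i, f (eig X i)) := by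
  rw [normFun_kyFan_eq hX hu hf, Finset.filter_true_of_mem fun i _ => i.2,
    sum_eig_cfc hX.1 f fun x => x]

/-- A linear functional on a finite-dimensional space is bounded with respect to every norm. -/
lemma exists_norm_le_mul_of_definite {E : Type*} [AddCommGroup E] [Module ℂ E]
    [FiniteDimensional ℂ E] (ρ : Seminorm ℂ E) (hρ : ∀ x, ρ x = 0 → x = 0) (l : E →ₗ[ℂ] ℂ) :
    ∃ K : ℝ, 0 ≤ K ∧ ∀ x, ‖l x‖ ≤ K * ρ x := by
  let _ : Norm E := ⟨ρ⟩
  have core : NormedSpace.Core ℂ E :=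
    { norm_nonneg := apply_nonneg ρ
      norm_smul := map_smul_eq_mul ρ
      norm_triangle := map_add_le_add ρ
      norm_eq_zero_iff := fun x => ⟨hρ x, fun h => by rw [h]; exact map_zero ρ⟩ }
  let _ : NormedAddCommGroup E := NormedAddCommGroup.ofCore core
  let _ : NormedSpace ℂ E := NormedSpace.ofCore core
  exact ⟨‖l.toContinuousLinearMap‖, norm_nonneg _, l.toContinuousLinearMap.le_opNorm⟩

/-- `tr f(X)` is bounded by a multiple of the norm of `f(X)`. -/
lemma exists_sum_le_mul_of_definite {ρ : Seminorm ℂ (SquareTensor I)}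
    (hρ : ∀ X, ρ X = 0 → X = 0) :
    ∃ K : ℝ, 0 ≤ K ∧ ∀ X : SquareTensor I, X.IsHermitian → ∀ f : ℝ → ℝ,
      ∑ i, f (eig X i) ≤ K * ρ (cfc f X) := by
  obtain ⟨K, hK, h⟩ := exists_norm_le_mul_of_definite ρ hρ (Matrix.traceLinearMap _ ℂ ℂ)
  refine ⟨K, hK, fun X hX f => le_trans ?_ (h (cfc f X))⟩
  rw [← sum_eig_cfc hX f fun x => x, ← trace_re_eq (isHermitian_cfc f X)]
  exact Complex.re_le_norm _

/-! ### Measurability of eigenvalues -/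

/-- The `i`-th eigenvalue exceeds `t` iff more than `i` eigenvalues do; the functions
`min 1 (n (x - t)⁺)` increase to the indicator of `(t, ∞)`. -/
lemma lt_eig_iff {X : SquareTensor I} (i : Fin (numEig I)) (t : ℝ) :
    t < eig X i ↔ ∃ n : ℕ, (i : ℝ) < ∑ j, min 1 (n * max (eig X j - t) 0) := by
  have h0 : ∀ (n : ℕ) j, 0 ≤ min 1 ((n : ℝ) * max (eig X j - t) 0) := fun n j => by positivity
  have hcard : ∀ k ≤ numEig I, ∑ j : Fin (numEig I), (if j.val < k then (1 : ℝ) else 0) = k :=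
    fun k hk => by rw [← Finset.sum_filter, Finset.sum_const, card_filter_val_lt hk]; simp
  constructor
  · intro h
    obtain ⟨n, hn⟩ := exists_nat_gt (1 / (eig X i - t))
    have hpos := sub_pos.2 h
    rw [div_lt_iff₀ hpos] at hn
    refine ⟨n, lt_of_lt_of_le (lt_add_one (i : ℝ)) ?_⟩
    have := hcard (i + 1) i.2
    push_cast at this
    rw [← this]
    refine Finset.sum_le_sum fun j _ => ?_
    split_ifs with hj
    · have : eig X i ≤ eig X j := eig_antitone X (Fin.le_def.2 (Nat.lt_succ_iff.1 hj))
      refine le_min le_rfl (hn.le.trans ?_)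
      gcongr
      exact le_max_of_le_left (by linarith)
    · exact h0 n j
  · rintro ⟨n, hn⟩
    by_contra h
    refine absurd hn (not_lt.2 ?_)
    rw [← hcard i i.2.le]
    refine Finset.sum_le_sum fun j _ => ?_
    split_ifs with hj
    · exact min_le_left _ _
    · have : eig X j ≤ eig X i := eig_antitone X (Fin.le_def.2 (not_lt.1 hj))
      rw [max_eq_right (by linarith), mul_zero]
      exact min_le_right _ _

open scoped Matrix.Norms.L2Operator in
lemma continuous_cfc_of_spectrum_subset {Ω : Type*} [TopologicalSpace Ω] {D : Ω → SquareTensor I}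
    (hD : Continuous D) (hH : ∀ τ, (D τ).IsHermitian) {K : Set ℝ} (hK : IsCompact K)
    (hDK : ∀ τ, spectrum ℝ (D τ) ⊆ K) {f : ℝ → ℝ} (hf : Continuous f) :
    Continuous fun τ => cfc f (D τ) :=
  Continuous.cfc (s := fun _ => K) f hD (fun _ => hK) (fun _ => Eventually.of_forall hDK)
    (fun _ => hf.continuousOn) hH

lemma measurable_eig {Ω : Type*} [TopologicalSpace Ω] [MeasurableSpace Ω] [BorelSpace Ω]
    {D : Ω → SquareTensor I} (hD : Continuous D) (hH : ∀ τ, (D τ).IsHermitian) {K : Set ℝ}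
    (hK : IsCompact K) (hDK : ∀ τ i, eig (D τ) i ∈ K) (i : Fin (numEig I)) :
    Measurable fun τ => eig (D τ) i := by
  refine measurable_of_Ioi fun t => IsOpen.measurableSet ?_
  have : (fun τ => eig (D τ) i) ⁻¹' Ioi t
      = ⋃ n : ℕ, {τ | (i : ℝ) < ∑ j, min 1 (n * max (eig (D τ) j - t) 0)} := by
    ext τ; simp only [mem_preimage, mem_Ioi, mem_iUnion, mem_ofPred_eq]; exact lt_eig_iff i t
  rw [this]
  refine isOpen_iUnion fun n => isOpen_lt continuous_const ?_
  have hc := continuous_cfc_of_spectrum_subset hD hH hK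
    (fun τ => by rw [← range_eig (hH τ)]; exact range_subset_iff.2 (hDK τ))
    (f := fun x : ℝ => min 1 (n * max (x - t) 0)) (by fun_prop)
  refine (Complex.continuous_re.comp hc.matrix_trace).congr fun τ => ?_
  rw [Function.comp_apply, trace_re_eq (isHermitian_cfc _ _), sum_eig_cfc (hH τ) _ fun x => x]

end Eigenvalues

/-! ### Logarithms of the eigenvalues of the family -/

section Family

lemma atZero_rpow_neg {p : ℝ} (hp : 0 < p) : atZero (fun x => x ^ (-p)) = ⊤ :=
  (ENNReal.tendsto_ofReal_atTop.comp (tendsto_rpow_neg_nhdsGT_zero (neg_lt_zero.2 hp))).limsup_eq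

variable {N : ℕ} {I : Fin N → ℕ} {Ω : Type*} [MeasurableSpace Ω] {ν : Measure Ω}
  {D : Ω → SquareTensor I}

/-- Finiteness of `∫ ‖D_τ^(-p)‖ dν` for one `p > 0` makes almost all `D_τ` invertible. -/
lemma ae_isUnit_of_lintegral_normFun_lt_top [TopologicalSpace Ω] [BorelSpace Ω]
    (hD : Continuous D) {nrm : SquareTensor I → ℝ} {p : ℝ} (hp : 0 < p)
    (hint : ∫⁻ τ, normFun nrm (fun x => x ^ (-p)) (D τ) ∂ν < ⊤) :
    ∀ᵐ τ ∂ν, IsUnit (D τ) := by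
  have hB : MeasurableSet {τ | ¬ IsUnit (D τ)} := by
    have : {τ | ¬ IsUnit (D τ)} = (fun τ => (D τ).det) ⁻¹' {0} := by
      ext τ; simp [Matrix.isUnit_iff_isUnit_det, isUnit_iff_ne_zero]
    rw [this]
    exact (isClosed_singleton.preimage hD.matrix_det).measurableSet
  rw [ae_iff]
  by_contra hne
  have h1 : ∫⁻ τ, indicator {τ | ¬ IsUnit (D τ)} (fun _ => ⊤) τ ∂ν
      ≤ ∫⁻ τ, normFun nrm (fun x => x ^ (-p)) (D τ) ∂ν := by
    refine lintegral_mono fun τ => ?_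
    by_cases hτ : IsUnit (D τ)
    · rw [indicator_of_notMem (by simpa using hτ)]
      exact bot_le
    · rw [normFun, if_pos ⟨atZero_rpow_neg hp, hτ⟩]
      exact le_top
  rw [lintegral_indicator_const hB, ENNReal.top_mul hne, top_le_iff] at h1
  exact hint.ne h1

lemma integrable_inv_eig (hD : ∀ τ, IsNonnegHermitian (D τ))
    (hmeas : ∀ i, Measurable fun τ => eig (D τ) i) (hu : ∀ᵐ τ ∂ν, IsUnit (D τ))
    {ρ : Seminorm ℂ (SquareTensor I)} (hρ : ∀ X, ρ X = 0 → X = 0)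
    (hint : ∫⁻ τ, normFun ρ (fun x => x ^ (-1 : ℝ)) (D τ) ∂ν < ⊤) (i : Fin (numEig I)) :
    Integrable (fun τ => (eig (D τ) i)⁻¹) ν := by
  obtain ⟨K, hK, hb⟩ := exists_sum_le_mul_of_definite hρ
  refine (lintegral_ofReal_ne_top_iff_integrable (hmeas i).inv.aestronglyMeasurable
    (Eventually.of_forall fun τ => inv_nonneg.2 ((hD τ).2 i))).1 (ne_of_lt ?_)
  calc ∫⁻ τ, ENNReal.ofReal (eig (D τ) i)⁻¹ ∂ν
      ≤ ∫⁻ τ, ENNReal.ofReal K * normFun ρ (fun x => x ^ (-1 : ℝ)) (D τ) ∂ν := by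
        refine lintegral_mono_ae ?_
        filter_upwards [hu] with τ hτ
        rw [normFun_eq_of_isUnit (hD τ) hτ, ← ENNReal.ofReal_mul hK]
        refine ENNReal.ofReal_le_ofReal (le_trans ?_ (hb (D τ) (hD τ).1 _))
        simp only [Real.rpow_neg_one]
        exact Finset.single_le_sum (f := fun i => (eig (D τ) i)⁻¹)
          (fun j _ => inv_nonneg.2 ((hD τ).2 j)) (Finset.mem_univ i)
    _ = ENNReal.ofReal K * ∫⁻ τ, normFun ρ (fun x => x ^ (-1 : ℝ)) (D τ) ∂ν :=
        lintegral_const_mul' _ _ ENNReal.ofReal_ne_top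
    _ < ⊤ := ENNReal.mul_lt_top ENNReal.ofReal_lt_top hint

lemma eig_le_kyFan_one {X : SquareTensor I} (hX : IsNonnegHermitian X) (i : Fin (numEig I)) :
    eig X i ≤ kyFan 1 X := by
  have h0 : 0 < numEig I := i.pos
  rw [kyFan_eq hX]
  refine (eig_antitone X (show (⟨0, h0⟩ : Fin (numEig I)) ≤ i from Nat.zero_le _)).trans ?_
  exact Finset.single_le_sum (f := eig X) (fun j _ => hX.2 j) (by simp)

lemma integrable_log_of_inv {d : Ω → ℝ} (hpos : ∀ᵐ τ ∂ν, 0 < d τ) (hd : Integrable d ν)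
    (hinv : Integrable (fun τ => (d τ)⁻¹) ν) : Integrable (fun τ => Real.log (d τ)) ν := by
  refine (hd.add hinv).mono'
    (Real.measurable_log.comp_aemeasurable hd.1.aemeasurable).aestronglyMeasurable ?_
  filter_upwards [hpos] with τ hτ
  have h1 := Real.log_le_sub_one_of_pos hτ
  have h2 := Real.log_le_sub_one_of_pos (inv_pos.2 hτ)
  rw [Real.log_inv] at h2
  have h3 := inv_pos.2 hτ
  rw [Real.norm_eq_abs, abs_le]
  simp only [Pi.add_apply]
  constructor <;> linarith

/-- Log-majorization by positive numbers `exp (m_i)` is majorization of logarithms; the equality of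
the full products forces positivity. -/
lemma logMajorizedBy_ofReal_exp_iff {r : ℕ} {c m : Fin r → ℝ} (hc : ∀ i, 0 ≤ c i) :
    LogMajorizedBy (fun i => ENNReal.ofReal (c i)) (fun i => ENNReal.ofReal (Real.exp (m i))) ↔
      (∀ i, 0 < c i) ∧ (∀ k, 1 ≤ k → k ≤ r → ∑ i : Fin r with i.val < k, Real.log (c i)
        ≤ ∑ i : Fin r with i.val < k, m i) ∧ ∑ i, Real.log (c i) = ∑ i, m i := by
  have hp1 : ∀ S : Finset (Fin r), ∏ i ∈ S, ENNReal.ofReal (c i) = ENNReal.ofReal (∏ i ∈ S, c i) :=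
    fun S => (ENNReal.ofReal_prod_of_nonneg fun i _ => hc i).symm
  have hp2 : ∀ S : Finset (Fin r), ∏ i ∈ S, ENNReal.ofReal (Real.exp (m i))
      = ENNReal.ofReal (Real.exp (∑ i ∈ S, m i)) := fun S => by
    rw [Real.exp_sum]; exact (ENNReal.ofReal_prod_of_nonneg fun i _ => (Real.exp_pos _).le).symm
  have hp0 : ∀ S : Finset (Fin r), 0 ≤ ∏ i ∈ S, c i := fun S => Finset.prod_nonneg fun i _ => hc i
  have hlog : (∀ i, 0 < c i) → ∀ S : Finset (Fin r),
      ∏ i ∈ S, c i = Real.exp (∑ i ∈ S, Real.log (c i)) := fun hpos S => by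
    rw [Real.exp_sum]; exact Finset.prod_congr rfl fun i _ => (Real.exp_log (hpos i)).symm
  simp only [LogMajorizedBy, hp1, hp2, ENNReal.ofReal_le_ofReal_iff (Real.exp_pos _).le,
    ENNReal.ofReal_eq_ofReal_iff (hp0 _) (Real.exp_pos _).le]
  constructor
  · rintro ⟨h1, h2⟩
    have hpos : ∀ i, 0 < c i := fun i => lt_of_le_of_ne (hc i) fun h0 =>
      (Real.exp_pos (∑ i, m i)).ne' (h2 ▸ Finset.prod_eq_zero (Finset.mem_univ i) h0.symm)
    simp only [hlog hpos, Real.exp_le_exp, Real.exp_eq_exp] at h1 h2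
    exact ⟨hpos, h1, h2⟩
  · rintro ⟨hpos, h1, h2⟩
    simp only [hlog hpos, Real.exp_le_exp, Real.exp_eq_exp]
    exact ⟨h1, h2⟩

lemma expIntLog_eig (hD : ∀ τ, IsNonnegHermitian (D τ)) (hu : ∀ᵐ τ ∂ν, IsUnit (D τ))
    {i : Fin (numEig I)} (hlog : Integrable (fun τ => Real.log (eig (D τ) i)) ν) :
    expIntLog ν (fun τ => ENNReal.ofReal (eig (D τ) i))
      = ENNReal.ofReal (Real.exp (∫ τ, Real.log (eig (D τ) i) ∂ν)) := by
  rw [← expIntLog_ofReal_exp hlog]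
  refine expIntLog_congr_ae ?_
  filter_upwards [hu] with τ hτ
  rw [Real.exp_log ((isUnit_iff_forall_eig_pos (hD τ)).1 hτ i)]

end Family

/-! ### From log-majorization to norm inequalities -/

section Forward

variable {N : ℕ} {I : Fin N → ℕ} {Ω : Type*} [MeasurableSpace Ω] {ν : Measure Ω}
  {C : SquareTensor I} {D : Ω → SquareTensor I}

/-- Log-majorization and convexity of `x ↦ f(e^x)` bound the Ky Fan norm of `f(C)` by a sum of `k`
values of `f` at the geometric means of the eigenvalues. -/
lemma exists_normFun_kyFan_le (hC : IsNonnegHermitian C) {m : Fin (numEig I) → ℝ}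
    (hmaj : LogMajorizedBy (fun i => ENNReal.ofReal (eig C i))
      (fun i => ENNReal.ofReal (Real.exp (m i)))) {f : ℝ → ℝ} (hf : ∀ x, 0 < x → 0 ≤ f x)
    (hconv : ConvexExp f) {k : ℕ} (hk1 : 1 ≤ k) (hkr : k ≤ numEig I) :
    ∃ S : Finset (Fin (numEig I)), S.card = k ∧
      normFun (kyFan k) f C ≤ ENNReal.ofReal (∑ i ∈ S, f (Real.exp (m i))) := by
  obtain ⟨hpos, h1, h2⟩ := (logMajorizedBy_ofReal_exp_iff hC.2).1 hmaj
  have hanti : Antitone fun i => Real.log (eig C i) := fun i j hij =>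
    Real.log_le_log (hpos j) (eig_antitone C hij)
  obtain ⟨S, hS, h⟩ := exists_finset_sum_le_of_majorized hanti h1 h2 hconv (w := eig (cfc f C))
    (fun ψ => by simp only [Real.exp_log (hpos _)]; exact sum_eig_cfc hC.1 f ψ) hk1 hkr
  refine ⟨S, hS, ?_⟩
  rw [normFun_kyFan_eq hC ((isUnit_iff_forall_eig_pos hC).2 hpos) hf]
  exact ENNReal.ofReal_le_ofReal h

variable [IsProbabilityMeasure ν]

lemma normFun_kyFan_le_lintegral (hC : IsNonnegHermitian C)
    (hD : ∀ τ, IsNonnegHermitian (D τ)) (hu : ∀ᵐ τ ∂ν, IsUnit (D τ))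
    (hlog : ∀ i, Integrable (fun τ => Real.log (eig (D τ) i)) ν)
    (hmaj : LogMajorizedBy (fun i => ENNReal.ofReal (eig C i))
      (fun i => ENNReal.ofReal (Real.exp (∫ τ, Real.log (eig (D τ) i) ∂ν))))
    {g : ℝ → ℝ} (hg : ∀ x, 0 < x → 0 ≤ g x) (hconv : ConvexExp g)
    {k : ℕ} (hk1 : 1 ≤ k) (hkr : k ≤ numEig I) :
    normFun (kyFan k) g C ≤ ∫⁻ τ, normFun (kyFan k) g (D τ) ∂ν := by
  obtain ⟨S, rfl, h⟩ := exists_normFun_kyFan_le hC hmaj hg hconv hk1 hkr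
  have h0 : ∀ x, 0 ≤ g (Real.exp x) := fun x => hg _ (Real.exp_pos x)
  have hcont : Continuous fun x => g (Real.exp x) :=
    continuousOn_univ.1 (ConvexOn.continuousOn isOpen_univ hconv)
  refine h.trans ?_
  rw [ENNReal.ofReal_sum_of_nonneg fun i _ => h0 _]
  calc ∑ i ∈ S, ENNReal.ofReal (g (Real.exp (∫ τ, Real.log (eig (D τ) i) ∂ν)))
      ≤ ∑ i ∈ S, ∫⁻ τ, ENNReal.ofReal (g (Real.exp (Real.log (eig (D τ) i)))) ∂ν :=
        Finset.sum_le_sum fun i _ => ofReal_convexOn_integral_le hconv h0 (hlog i)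
    _ = ∫⁻ τ, ∑ i ∈ S, ENNReal.ofReal (g (Real.exp (Real.log (eig (D τ) i)))) ∂ν :=
        (lintegral_finsetSum' S fun i _ =>
          (hcont.comp_aestronglyMeasurable (hlog i).1).aemeasurable.ennreal_ofReal).symm
    _ ≤ _ := by
        refine lintegral_mono_ae ?_
        filter_upwards [hu] with τ hτ
        simp only [Real.exp_log ((isUnit_iff_forall_eig_pos (hD τ)).1 hτ _)]
        rw [← ENNReal.ofReal_sum_of_nonneg fun i _ =>
          hg _ ((isUnit_iff_forall_eig_pos (hD τ)).1 hτ i)]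
        exact ofReal_sum_le_normFun_kyFan (hD τ) hτ hg hk1

/-- A function `f` with `log f(e^x)` convex in the extended sense vanishes identically or is
positive with a real-valued convex logarithm. -/
lemma LogConvexExp.eq_zero_or_convexOn {f : ℝ → ℝ} (hf : ∀ x, 0 < x → 0 ≤ f x)
    (h : LogConvexExp f) : (∀ x, f (Real.exp x) = 0) ∨
      ((∀ x, 0 < f (Real.exp x)) ∧ ConvexOn ℝ univ fun x => Real.log (f (Real.exp x))) := by
  by_cases h0 : ∃ x, f (Real.exp x) = 0
  · left
    obtain ⟨x, hx⟩ := h0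
    intro z
    -- `z` is the midpoint of the zero `x` and of `2 z - x`.
    have h1 := h x (2 * z - x) (1 / 2) (1 / 2) (by norm_num) (by norm_num) (by norm_num)
    rw [show 1 / 2 * x + 1 / 2 * (2 * z - x) = z by ring, hx, ENNReal.ofReal_zero,
      ENNReal.log_zero, EReal.coe_mul_bot_of_pos (by norm_num), EReal.bot_add, le_bot_iff,
      ENNReal.log_eq_bot_iff, ENNReal.ofReal_eq_zero] at h1
    exact le_antisymm h1 (hf _ (Real.exp_pos z))
  · right
    have hpos : ∀ x, 0 < f (Real.exp x) := fun x =>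
      lt_of_le_of_ne (hf _ (Real.exp_pos x)) fun hx => h0 ⟨x, hx.symm⟩
    refine ⟨hpos, convexOn_iff_forall_pos.2 ⟨convex_univ, fun x _ y _ a b ha hb hab => ?_⟩⟩
    have h1 := h x y a b ha hb hab
    simp only [ENNReal.log_ofReal, (hpos _).not_ge, if_false] at h1
    exact_mod_cast h1

lemma LogConvexExp.convexExp {f : ℝ → ℝ} (hf : ∀ x, 0 < x → 0 ≤ f x) (h : LogConvexExp f) :
    ConvexExp f := by
  rcases h.eq_zero_or_convexOn hf with h0 | ⟨hpos, hF⟩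
  · unfold ConvexExp
    simp only [h0]
    exact convexOn_const 0 convex_univ
  · refine ⟨convex_univ, fun x _ y _ a b ha hb hab => ?_⟩
    have h1 := hF.2 (mem_univ x) (mem_univ y) ha hb hab
    have h2 := convexOn_exp.2 (mem_univ (Real.log (f (Real.exp x))))
      (mem_univ (Real.log (f (Real.exp y)))) ha hb hab
    simp only [smul_eq_mul, Real.exp_log (hpos _)] at h1 h2 ⊢
    rw [Real.log_le_iff_le_exp (hpos _)] at h1
    exact h1.trans h2

lemma normFun_kyFan_le_expIntLog (hC : IsNonnegHermitian C)
    (hD : ∀ τ, IsNonnegHermitian (D τ)) (hu : ∀ᵐ τ ∂ν, IsUnit (D τ))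
    (hlog : ∀ i, Integrable (fun τ => Real.log (eig (D τ) i)) ν)
    (hmaj : LogMajorizedBy (fun i => ENNReal.ofReal (eig C i))
      (fun i => ENNReal.ofReal (Real.exp (∫ τ, Real.log (eig (D τ) i) ∂ν))))
    {f : ℝ → ℝ} (hf : ∀ x, 0 < x → 0 ≤ f x) (hconv : LogConvexExp f)
    {k : ℕ} (hk1 : 1 ≤ k) (hkr : k ≤ numEig I) :
    normFun (kyFan k) f C ≤ expIntLog ν fun τ => normFun (kyFan k) f (D τ) := by
  obtain ⟨S, rfl, h⟩ := exists_normFun_kyFan_le hC hmaj hf (hconv.convexExp hf) hk1 hkr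
  refine h.trans ?_
  rcases hconv.eq_zero_or_convexOn hf with h0 | ⟨hpos, hF⟩
  · simp [h0]
  have h1 := ofReal_sum_exp_convexOn_le (Finset.card_pos.1 hk1) hF hlog
  simp only [Real.exp_log (hpos _)] at h1
  refine h1.trans (expIntLog_mono_ae ?_)
  filter_upwards [hu] with τ hτ
  simp only [Real.exp_log ((isUnit_iff_forall_eig_pos (hD τ)).1 hτ _)]
  exact ofReal_sum_le_normFun_kyFan (hD τ) hτ hf hk1

end Forward

/-! ### From norm inequalities for powers to log-majorization -/

section Backward

variable {Ω : Type*} [MeasurableSpace Ω] {ν : Measure Ω} [IsProbabilityMeasure ν]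

/-- The geometric mean is at most the arithmetic mean. -/
lemma expIntLog_ofReal_sum_exp_le {ι : Type*} {S : Finset ι} (hS : S.Nonempty) {u : ι → Ω → ℝ}
    (hu : ∀ i, Integrable (u i) ν) :
    expIntLog ν (fun τ => ENNReal.ofReal (∑ i ∈ S, Real.exp (u i τ)))
      ≤ ∫⁻ τ, ENNReal.ofReal (∑ i ∈ S, Real.exp (u i τ)) ∂ν := by
  set Z : Ω → ℝ := fun τ => ∑ i ∈ S, Real.exp (u i τ)
  have hZpos : ∀ τ, 0 < Z τ := fun τ => Finset.sum_pos (fun i _ => Real.exp_pos _) hS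
  have hZmeas : AEMeasurable Z ν := Finset.aemeasurable_fun_sum S fun i _ =>
    Real.measurable_exp.comp_aemeasurable (hu i).1.aemeasurable
  by_cases hfin : ∫⁻ τ, ENNReal.ofReal (Z τ) ∂ν = ⊤
  · rw [hfin]; exact le_top
  have hZ : Integrable Z ν := (lintegral_ofReal_ne_top_iff_integrable hZmeas.aestronglyMeasurable
    (Eventually.of_forall fun τ => (hZpos τ).le)).1 hfin
  obtain ⟨j, hj⟩ := hS
  -- `log Z` lies between the integrable functions `u j` and `Z`.
  have hlog : Integrable (fun τ => Real.log (Z τ)) ν := by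
    refine integrable_of_le_of_le
      (Real.measurable_log.comp_aemeasurable hZmeas).aestronglyMeasurable
      (Eventually.of_forall fun τ => ?_) (Eventually.of_forall fun τ => ?_) (hu j) hZ
    · rw [Real.le_log_iff_exp_le (hZpos τ)]
      exact Finset.single_le_sum (f := fun i => Real.exp (u i τ))
        (fun i _ => (Real.exp_pos _).le) hj
    · linarith [Real.log_le_sub_one_of_pos (hZpos τ)]
  have e : ∀ τ, ENNReal.ofReal (Z τ) = ENNReal.ofReal (Real.exp (Real.log (Z τ))) := fun τ => by
    rw [Real.exp_log (hZpos τ)]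
  change expIntLog ν (fun τ => ENNReal.ofReal (Z τ)) ≤ ∫⁻ τ, ENNReal.ofReal (Z τ) ∂ν
  simp only [e]
  rw [expIntLog_ofReal_exp hlog]
  exact ofReal_convexOn_integral_le convexOn_exp (fun x => (Real.exp_pos x).le) hlog

/-- Inequalities between power sums of `exp (a_i)` and integrals of power sums of `exp (u_i)`
degenerate to an inequality between the sums of logarithms as the exponent tends to `0`. -/
lemma sum_le_sum_integral_of_powers {ι : Type*} {S : Finset ι} {a : ι → ℝ} {u : ι → Ω → ℝ}
    (hu : ∀ i, Integrable (u i) ν) (he : ∀ i, Integrable (fun τ => Real.exp (u i τ)) ν)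
    (h : ∀ p : ℝ, 0 < p → ENNReal.ofReal (∑ i ∈ S, Real.exp (p * a i))
      ≤ ∫⁻ τ, ENNReal.ofReal (∑ i ∈ S, Real.exp (p * u i τ)) ∂ν) :
    ∑ i ∈ S, a i ≤ ∑ i ∈ S, ∫ τ, u i τ ∂ν := by
  refine ge_of_tendsto' (tendsto_finsetSum S fun i _ =>
    tendsto_integral_exp_mul_sub_one_div (hu i) (he i)) fun n => ?_
  have hp : (0 : ℝ) < 1 / ((n : ℝ) + 1) := by positivity
  have hp1 : 1 / ((n : ℝ) + 1) ≤ 1 := by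
    rw [div_le_one (by positivity)]; linarith [(Nat.cast_nonneg n : (0 : ℝ) ≤ n)]
  set p := 1 / ((n : ℝ) + 1)
  have hi : ∀ i, Integrable (fun τ => Real.exp (p * u i τ)) ν := fun i => by
    refine ((integrable_const 1).add (he i)).mono'
      ((by fun_prop : Continuous fun x : ℝ => Real.exp (p * x)).comp_aestronglyMeasurable (hu i).1)
      (Eventually.of_forall fun τ => ?_)
    rw [Real.norm_of_nonneg (Real.exp_pos _).le]
    simp only [Pi.add_apply]
    rcases le_total 0 (u i τ) with h0 | h0
    · have : Real.exp (p * u i τ) ≤ Real.exp (u i τ) := Real.exp_le_exp.2 (by nlinarith)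
      linarith
    · have : Real.exp (p * u i τ) ≤ 1 := Real.exp_le_one_iff.2 (by nlinarith)
      linarith [Real.exp_pos (u i τ)]
  have h1 := h p hp
  rw [← ofReal_integral_eq_lintegral_ofReal (integrable_finsetSum S fun i _ => hi i)
    (Eventually.of_forall fun τ => Finset.sum_nonneg fun i _ => (Real.exp_pos _).le),
    integral_finsetSum S fun i _ => hi i, ENNReal.ofReal_le_ofReal_iff
    (Finset.sum_nonneg fun i _ => integral_nonneg fun τ => (Real.exp_pos _).le)] at h1
  have e : ∀ i, ∫ τ, (Real.exp (p * u i τ) - 1) / p ∂ν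
      = (∫ τ, Real.exp (p * u i τ) ∂ν - 1) / p := fun i => by
    rw [integral_div, integral_sub (hi i) (integrable_const 1)]; simp
  calc ∑ i ∈ S, a i ≤ ∑ i ∈ S, (Real.exp (p * a i) - 1) / p :=
        Finset.sum_le_sum fun i _ => by
          rw [le_div_iff₀ hp]; linarith [Real.add_one_le_exp (p * a i)]
    _ ≤ ∑ i ∈ S, (∫ τ, Real.exp (p * u i τ) ∂ν - 1) / p := by
        rw [← Finset.sum_div, ← Finset.sum_div, Finset.sum_sub_distrib, Finset.sum_sub_distrib]
        gcongr
    _ = _ := by simp only [e]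

variable {N : ℕ} {I : Fin N → ℕ} {C : SquareTensor I} {D : Ω → SquareTensor I}

lemma normFun_kyFan_rpow {X : SquareTensor I} (hX : IsNonnegHermitian X) (hu : IsUnit X)
    {p : ℝ} (hp : 0 < p) {k : ℕ} (hk1 : 1 ≤ k) (hkr : k ≤ numEig I) :
    normFun (kyFan k) (fun x => x ^ p) X = ENNReal.ofReal
      (∑ i : Fin (numEig I) with i.val < k, Real.exp (p * Real.log (eig X i))) := by
  rw [normFun_kyFan_eq_of_monotoneOn hX hu (fun x hx => Real.rpow_nonneg hx.le p)
    ((Real.monotoneOn_rpow_Ici_of_exponent_nonneg hp.le).mono Ioi_subset_Ici_self) hk1 hkr]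
  simp only [Real.rpow_def_of_pos ((isUnit_iff_forall_eig_pos hX).1 hu _), mul_comm]

lemma normFun_kyFan_numEig_rpow_neg {X : SquareTensor I} (hX : IsNonnegHermitian X)
    (hu : IsUnit X) (p : ℝ) :
    normFun (kyFan (numEig I)) (fun x => x ^ (-p)) X
      = ENNReal.ofReal (∑ i, Real.exp (p * -Real.log (eig X i))) := by
  rw [normFun_kyFan_numEig hX hu fun x hx => Real.rpow_nonneg hx.le _]
  simp only [Real.rpow_def_of_pos ((isUnit_iff_forall_eig_pos hX).1 hu _), mul_neg, neg_mul, mul_comm]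

/-- Positive powers give the inequalities between partial products, and negative powers give the
invertibility of `C` and the reverse inequality between full products. -/
lemma logMajorizedBy_of_powers (hC : IsNonnegHermitian C)
    (hD : ∀ τ, IsNonnegHermitian (D τ)) (hu : ∀ᵐ τ ∂ν, IsUnit (D τ))
    (hlog : ∀ i, Integrable (fun τ => Real.log (eig (D τ) i)) ν)
    (hint : ∀ i, Integrable (fun τ => eig (D τ) i) ν)
    (hinv : ∀ i, Integrable (fun τ => (eig (D τ) i)⁻¹) ν)
    (hpos : ∀ p : ℝ, 0 < p → ∀ k, 1 ≤ k → k ≤ numEig I →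
      normFun (kyFan k) (fun x => x ^ p) C ≤ ∫⁻ τ, ENNReal.ofReal
        (∑ i : Fin (numEig I) with i.val < k, Real.exp (p * Real.log (eig (D τ) i))) ∂ν)
    (hneg : 1 ≤ numEig I → ∀ p : ℝ, 0 < p →
      normFun (kyFan (numEig I)) (fun x => x ^ (-p)) C
        ≤ ∫⁻ τ, ENNReal.ofReal (∑ i, Real.exp (p * -Real.log (eig (D τ) i))) ∂ν) :
    LogMajorizedBy (fun i => ENNReal.ofReal (eig C i))
      (fun i => ENNReal.ofReal (Real.exp (∫ τ, Real.log (eig (D τ) i) ∂ν))) := by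
  have hexp : ∀ i, Integrable (fun τ => Real.exp (Real.log (eig (D τ) i))) ν := fun i => by
    refine (hint i).congr ?_
    filter_upwards [hu] with τ hτ
    rw [Real.exp_log ((isUnit_iff_forall_eig_pos (hD τ)).1 hτ i)]
  have hexpneg : ∀ i, Integrable (fun τ => Real.exp (-Real.log (eig (D τ) i))) ν := fun i => by
    refine (hinv i).congr ?_
    filter_upwards [hu] with τ hτ
    rw [Real.exp_neg, Real.exp_log ((isUnit_iff_forall_eig_pos (hD τ)).1 hτ i)]
  rcases Nat.eq_zero_or_pos (numEig I) with hr | hr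
  · have : IsEmpty (Fin (numEig I)) := by rw [hr]; infer_instance
    exact ⟨fun k h1 h2 => by omega, by simp⟩
  -- For singular `C` the left-hand side of `hneg` at `p = 1` would be infinite.
  have hCu : IsUnit C := by
    by_contra hCu
    have h1 := hneg hr 1 one_pos
    rw [normFun, if_pos ⟨atZero_rpow_neg one_pos, hCu⟩, top_le_iff] at h1
    simp only [one_mul] at h1
    exact (integrable_finsetSum Finset.univ fun i _ => hexpneg i).lintegral_lt_top.ne h1
  have key : ∀ k, 1 ≤ k → k ≤ numEig I →
      ∑ i : Fin (numEig I) with i.val < k, Real.log (eig C i)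
        ≤ ∑ i : Fin (numEig I) with i.val < k, ∫ τ, Real.log (eig (D τ) i) ∂ν :=
    fun k hk1 hkr => sum_le_sum_integral_of_powers hlog hexp fun p hp => by
      rw [← normFun_kyFan_rpow hC hCu hp hk1 hkr]; exact hpos p hp k hk1 hkr
  refine (logMajorizedBy_ofReal_exp_iff hC.2).2
    ⟨(isUnit_iff_forall_eig_pos hC).1 hCu, key, le_antisymm ?_ ?_⟩
  · have := key (numEig I) hr le_rfl
    rwa [Finset.filter_true_of_mem fun i _ => i.2] at this
  · have := sum_le_sum_integral_of_powers (S := Finset.univ) (a := fun i => -Real.log (eig C i))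
      (u := fun i τ => -Real.log (eig (D τ) i)) (fun i => (hlog i).neg) hexpneg fun p hp => by
        rw [← normFun_kyFan_numEig_rpow_neg hC hCu]; exact hneg hr p hp
    simp only [integral_neg, Finset.sum_neg_distrib] at this
    exact neg_le_neg_iff.1 this

lemma isContNonneg_rpow (p : ℝ) : IsContNonneg fun x => x ^ p :=
  ⟨fun x hx => (Real.continuousAt_rpow_const x p (Or.inl hx.ne')).continuousWithinAt,
    fun _ hx => Real.rpow_nonneg hx.le p⟩

lemma logConvexExp_rpow (p : ℝ) : LogConvexExp fun x => x ^ p := fun x y a b _ _ _ => by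
  have e : ∀ x : ℝ, Real.exp x ^ p = Real.exp (x * p) := fun x => (Real.exp_mul x p).symm
  simp only [e, log_ofReal_exp]
  exact_mod_cast (by ring : (a * x + b * y) * p = a * (x * p) + b * (y * p)).le

end Backward

end TensorLogMaj

theorem mainTheorem3 {Ω : Type*} [MetricSpace Ω] [SigmaCompactSpace Ω] [MeasurableSpace Ω]
    [BorelSpace Ω] (ν : Measure Ω) [IsProbabilityMeasure ν]
    {N : ℕ} (I : Fin N → ℕ)
    (C : SquareTensor I) (hC : IsNonnegHermitian C)
    (D : Ω → SquareTensor I) (hD : ∀ τ, IsNonnegHermitian (D τ))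
    (hDcont : Continuous D) (hDbdd : BddAbove (range fun τ => kyFan 1 (D τ)))
    (ρ : Seminorm ℂ (SquareTensor I)) (hρ : IsUnitarilyInvariantNorm ρ)
    (hint : ∀ p : ℝ, 0 < p → ∫⁻ τ, normFun ρ (fun x => x ^ (-p)) (D τ) ∂ν < ⊤) :
    List.TFAE [
      LogMajorizedBy (fun i => ENNReal.ofReal (eig C i))
        (fun i => expIntLog ν fun τ => ENNReal.ofReal (eig (D τ) i)),
      ∀ f : ℝ → ℝ, IsContNonneg f → LogConvexExp f → ∀ k : ℕ, 1 ≤ k → k ≤ numEig I →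
        normFun (kyFan k) f C ≤ expIntLog ν fun τ => normFun (kyFan k) f (D τ),
      ∀ g : ℝ → ℝ, IsContNonneg g → ConvexExp g → ∀ k : ℕ, 1 ≤ k → k ≤ numEig I →
        normFun (kyFan k) g C ≤ ∫⁻ τ, normFun (kyFan k) g (D τ) ∂ν] := by
  obtain ⟨M, hM⟩ := hDbdd
  have hbd : ∀ τ i, eig (D τ) i ∈ Icc 0 M := fun τ i =>
    ⟨(hD τ).2 i, (eig_le_kyFan_one (hD τ) i).trans (hM (mem_range_self τ))⟩
  have hmeas : ∀ i, Measurable fun τ => eig (D τ) i := fun i =>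
    measurable_eig hDcont (fun τ => (hD τ).1) isCompact_Icc hbd i
  have hu : ∀ᵐ τ ∂ν, IsUnit (D τ) :=
    ae_isUnit_of_lintegral_normFun_lt_top hDcont one_pos (hint 1 one_pos)
  have hinteg : ∀ i, Integrable (fun τ => eig (D τ) i) ν := fun i =>
    Integrable.of_bound (hmeas i).aestronglyMeasurable M (Eventually.of_forall fun τ => by
      rw [Real.norm_of_nonneg (hbd τ i).1]; exact (hbd τ i).2)
  have hinv : ∀ i, Integrable (fun τ => (eig (D τ) i)⁻¹) ν :=
    integrable_inv_eig hD hmeas hu hρ.1 (hint 1 one_pos)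
  have hlog : ∀ i, Integrable (fun τ => Real.log (eig (D τ) i)) ν := fun i =>
    integrable_log_of_inv (hu.mono fun τ hτ => (isUnit_iff_forall_eig_pos (hD τ)).1 hτ i)
      (hinteg i) (hinv i)
  simp only [expIntLog_eig hD hu (hlog _)]
  have hposeq : ∀ p : ℝ, 0 < p → ∀ k, 1 ≤ k → k ≤ numEig I →
      (fun τ => normFun (kyFan k) (fun x => x ^ p) (D τ)) =ᵐ[ν] fun τ => ENNReal.ofReal
        (∑ i : Fin (numEig I) with i.val < k, Real.exp (p * Real.log (eig (D τ) i))) :=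
    fun p hp k hk1 hkr => hu.mono fun τ hτ => normFun_kyFan_rpow (hD τ) hτ hp hk1 hkr
  have hnegeq : ∀ p : ℝ, (fun τ => normFun (kyFan (numEig I)) (fun x => x ^ (-p)) (D τ)) =ᵐ[ν]
      fun τ => ENNReal.ofReal (∑ i, Real.exp (p * -Real.log (eig (D τ) i))) :=
    fun p => hu.mono fun τ hτ => normFun_kyFan_numEig_rpow_neg (hD τ) hτ p
  tfae_have 1 → 2 := fun h f hf hconv k hk1 hkr =>
    normFun_kyFan_le_expIntLog hC hD hu hlog h hf.2 hconv hk1 hkr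
  tfae_have 1 → 3 := fun h g hg hconv k hk1 hkr =>
    normFun_kyFan_le_lintegral hC hD hu hlog h hg.2 hconv hk1 hkr
  tfae_have 2 → 1 := fun h => by
    refine logMajorizedBy_of_powers hC hD hu hlog hinteg hinv (fun p hp k hk1 hkr => ?_)
      fun hr p hp => ?_
    · have hne : (Finset.univ.filter fun i : Fin (numEig I) => i.val < k).Nonempty :=
        ⟨⟨0, by omega⟩, by simp; omega⟩
      refine (h _ (isContNonneg_rpow p) (logConvexExp_rpow p) k hk1 hkr).trans ?_
      rw [expIntLog_congr_ae (hposeq p hp k hk1 hkr)]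
      exact expIntLog_ofReal_sum_exp_le hne fun i => (hlog i).const_mul p
    · refine (h _ (isContNonneg_rpow (-p)) (logConvexExp_rpow (-p)) _ hr le_rfl).trans ?_
      rw [expIntLog_congr_ae (hnegeq p)]
      exact expIntLog_ofReal_sum_exp_le ⟨⟨0, hr⟩, Finset.mem_univ _⟩
        fun i => (hlog i).neg.const_mul p
  tfae_have 3 → 1 := fun h => by
    have hconv : ∀ p : ℝ, ConvexExp fun x => x ^ p := fun p =>
      (logConvexExp_rpow p).convexExp (isContNonneg_rpow p).2
    refine logMajorizedBy_of_powers hC hD hu hlog hinteg hinv (fun p hp k hk1 hkr => ?_)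
      fun hr p hp => ?_
    · rw [← lintegral_congr_ae (hposeq p hp k hk1 hkr)]
      exact h _ (isContNonneg_rpow p) (hconv p) k hk1 hkr
    · rw [← lintegral_congr_ae (hnegeq p)]
      exact h _ (isContNonneg_rpow (-p)) (hconv (-p)) _ hr le_rfl
  tfae_finish
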